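/- **Conventions.** Let $\mathfrak S$ be a commutative $*$-semigroup with unit $\varepsilon$, i.e. a commutative semigroup with a unit and a map $s\mapsto s^*$ such that $(st)^*=t^*s^*$ and $(s^*)^*=s$. Let $\mathfrak X_{\mathfrak S}$ be the set of its characters, i.e. of all functions $\chi\colon\mathfrak S\to\mathbb C$ with $\chi(st)=\chi(s)\chi(t)$, $\chi(s^*)=\overline{\chi(s)}$ and $\chi(\varepsilon)=1$. Put $\hat s(\chi)=\chi(s)$, and let $\mathsf M_{\mathfrak S}$ be the smallest $\sigma$-algebra of subsets of $\mathfrak X_{\mathfrak S}$ making all $\hat s$, $s\in\mathfrak S$, measurable. A nonempty set $Y\subset\mathfrak X_{\mathfrak S}$ is *determining* if the system $\{\hat s|_Y\}_{s\in\mathfrak S}$ is linearly independent in $\mathbb C^Y$ (if such a $Y$ exists, then $\mathfrak X_{\mathfrak S}$ is determining too). For a complex linear space $\mathcal D$, let $\mathcal S(\mathcal D)$ be the space of sesquilinear forms on $\mathcal D$ (linear in the first variable). A map $\varPsi\colon\mathfrak S\to\mathcal S(\mathcal D)$ is *positive definite* if $\sum_{k,l=1}^m\varPsi(s_l^*s_k)(h_k,h_l)\ge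 0$ for all $m\ge1$, $s_1,\dots,s_m\in\mathfrak S$ and $h_1,\dots,h_m\in\mathcal D$. A *semispectral measure* on $\mathsf M_{\mathfrak S}$ is a map $\mu\colon\mathsf M_{\mathfrak S}\to\mathcal S(\mathcal D)$ such that $\mu(\cdot)(f,f)$ is a finite positive measure for every $f\in\mathcal D$. For $\phi\in\mathcal S(\mathcal D)$, the equality $\phi=\int_{\mathfrak X_{\mathfrak S}}\hat s\,\mathrm d\mu$ means that for all $f,g\in\mathcal D$ the function $\hat s$ is summable with respect to the complex measure $\mu(\cdot)(f,g)$ and $\phi(f,g)=\int_{\mathfrak X_{\mathfrak S}}\hat s(\chi)\,\mu(\mathrm d\chi)(f,g)$. $\mathfrak S$ is *operator semiperfect* if for every complex linear space $\mathcal D$ and every positive definite $\varPsi\colon\mathfrak S\to\mathcal S(\mathcal D)$ there is a semispectral measure $\mu$ on $\mathsf M_{\mathfrak S}$ with $\varPsi(s)=\int_{\mathfrak X_{\mathfrak S}}\hat s\,\mathrm d\mu$ for all $s\in\mathfrak S$. For $T\subset\mathfrak S$ and $Y\subset\mathfrak X_{\mathfrak S}$, let $\mathcal P_T(Y)$ be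 the linear span of $\{\hat s|_Y\colon s\in T\}$ in $\mathbb C^Y$, and let $\mathcal P(Y,\ell^2)$ be the set of all functions $Y\to\ell^2$ of the form $\chi\mapsto\sum_{s\in\mathfrak S}\chi(s)x_s$ with $x_s\in\ell^2$, $x_s=0$ for all but finitely many $s$. Let $\mathrm M_+^m(\mathcal P_T(Y))$ be the set of $m\times m$ matrices $[w_{k,l}]$ with entries in $\mathcal P_T(Y)$ such that the matrix $[w_{k,l}(\chi)]_{k,l=1}^m$ is nonnegative (positive semidefinite) for every $\chi\in Y$, and let $\mathrm M_{\mathrm f}^m(\mathcal P_T(Y))$ be the set of $m\times m$ matrices with entries in $\mathcal P_T(Y)$ of the form $w_{k,l}(\chi)=\langle p_k(\chi),p_l(\chi)\rangle_{\ell^2}$ with $p_1,\dots,p_m\in\mathcal P(Y,\ell^2)$ (inner product linear in the first variable). If $Y$ is determining and $\varPhi\colon T\to\mathcal S(\mathcal D)$, let $\varLambda_{\varPhi,Y}\colon\mathcal P_T(Y)\to\mathcal S(\mathcal D)$ be the unique linear map with $\varLambda_{\varPhi,Y}(\hat s|_Y)=\varPhi(s)$ for $s\in T$, and let $\varLambda_\varPhi=\varLambda_{\varPhi,\mathfrak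 X_{\mathfrak S}}$. The map $\varLambda_{\varPhi,Y}$ is *completely positive* (respectively *completely f-positive*) if for every $m\ge1$ and every $[w_{k,l}]$ in $\mathrm M_+^m(\mathcal P_T(Y))$ (respectively in $\mathrm M_{\mathrm f}^m(\mathcal P_T(Y))$), $$\sum_{k,l=1}^m\varLambda_{\varPhi,Y}(w_{k,l})(h_k,h_l)\ge0\quad\text{for all }h_1,\dots,h_m\in\mathcal D.$$ **Theorem 2.1.** Suppose that $\mathfrak S$ is an operator semiperfect commutative $*$-semigroup with unit, that $T\subset\mathfrak S$ is symmetric ($T=\{s^*\colon s\in T\}$) and contains all Hermitian elements of $\mathfrak S$ (those $s$ with $s=s^*$), and that $Y$ is a determining subset of $\mathfrak X_{\mathfrak S}$. Let $\mathcal D$ be a complex linear space. Then for every mapping $\varPhi\colon T\to\mathcal S(\mathcal D)$ the following four conditions are equivalent: 1. $\varPhi$ extends to a positive definite mapping $\varPsi\colon\mathfrak S\to\mathcal S(\mathcal D)$; 2. there is a semispectral measure $\mu$ on $\mathsf M_{\mathfrak S}$ such that $\varPhi(s)=\int_{\mathfrak X_{\mathfrak S}}\hat s\,\mathrm d\mu$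 for all $s\in T$; 3. $\varLambda_\varPhi$ is completely positive; 4. $\varLambda_{\varPhi,Y}$ is completely f-positive. -/

import Mathlib

open MeasureTheory
open scoped ComplexOrder ComplexConjugate

universe u v

noncomputable section

namespace StarSemigroup

/-! ### Sesquilinear forms and positive definite mappings -/

/-- Sesquilinear forms on a complex linear space `D`, linear in the first and conjugate-linear in
the second variable. -/
abbrev SesqForm (D : Type v) [AddCommGroup D] [Module ℂ D] : Type v :=
  D →ₗ[ℂ] D →ₗ⋆[ℂ] ℂ

/-- The cone of all `m × m` matrices `[φ k l]` of sesquilinear forms with `[φ k l] ≫ 0`, that is,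
`∑ k l, φ k l (h k) (h l) ≥ 0` for all vectors `h 1, …, h m`. (In the order of `ℂ`, `0 ≤ z` says
that `z` is real and nonnegative.) -/
def formMatrixPos (D : Type v) [AddCommGroup D] [Module ℂ D] (m : ℕ) :
    Set (Matrix (Fin m) (Fin m) (SesqForm D)) :=
  {φ | ∀ h : Fin m → D, 0 ≤ ∑ k, ∑ l, φ k l (h k) (h l)}

/-- Positive definiteness of a form-valued mapping on a `*`-semigroup. -/
def IsPositiveDefinite {S : Type u} [CommMonoid S] [StarMul S] {D : Type v} [AddCommGroup D]
    [Module ℂ D] (Ψ : S → SesqForm D) : Prop :=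
  ∀ (m : ℕ) (s : Fin m → S) (h : Fin m → D),
    0 ≤ ∑ k, ∑ l, Ψ (star (s l) * s k) (h k) (h l)

/-! ### The dual `*`-semigroup, determining sets -/

/-- The set of characters of the unital commutative `*`-semigroup `S`: multiplicative functions
`χ : S → ℂ` with `χ (star s) = conj (χ s)` and `χ 1 = 1`. -/
abbrev Dual (S : Type u) [CommMonoid S] [StarMul S] : Type u := S →⋆* ℂ

/-- The smallest `σ`-algebra on the dual that makes all the transforms `χ ↦ χ s` measurable. -/
instance Dual.instMeasurableSpace (S : Type u) [CommMonoid S] [StarMul S] :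
    MeasurableSpace (Dual S) :=
  ⨆ s : S, MeasurableSpace.comap (fun χ : Dual S => χ s) (borel ℂ)

/-- The transform `ŝ` of `s`, restricted to the set `Y` of characters. -/
def transform {S : Type u} [CommMonoid S] [StarMul S] (Y : Set (Dual S)) (s : S) : Y → ℂ :=
  fun χ => (χ : Dual S) s

/-- A nonempty set `Y` of characters is determining if the system `{ŝ|_Y}`, `s ∈ S`, is linearly
independent in `ℂ^Y`. -/
def IsDetermining {S : Type u} [CommMonoid S] [StarMul S] (Y : Set (Dual S)) : Prop :=
  Y.Nonempty ∧ LinearIndependent ℂ (transform Y)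

/-- If some set of characters is determining, then so is the whole dual. -/
theorem IsDetermining.univ {S : Type u} [CommMonoid S] [StarMul S] {Y : Set (Dual S)}
    (hY : IsDetermining Y) : IsDetermining (Set.univ : Set (Dual S)) := by
  refine ⟨hY.1.mono (Set.subset_univ Y), ?_⟩
  let i : Y → (Set.univ : Set (Dual S)) := fun χ => ⟨χ, Set.mem_univ _⟩
  let r := LinearMap.funLeft ℂ ℂ i
  exact LinearIndependent.of_comp r hY.2

/-- `𝒫_T(Y)`: the linear span of the functions `ŝ|_Y`, `s ∈ T`. -/
def polySpace {S : Type u} [CommMonoid S] [StarMul S] (T : Set S) (Y : Set (Dual S)) :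
    Submodule ℂ (Y → ℂ) :=
  Submodule.span ℂ (Set.range fun s : T => transform Y (s : S))

/-- The Hilbert space `ℓ²`. -/
abbrev Ell2 : Type := lp (fun _ : ℕ => ℂ) 2

/-- `𝒫(Y, ℓ²)`: the functions on `Y` of the form `χ ↦ ∑ s, χ s • x s`, where the `x s` are vectors
of `ℓ²`, all but finitely many of them zero. -/
def polySpaceEll2 {S : Type u} [CommMonoid S] [StarMul S] (Y : Set (Dual S)) : Set (Y → Ell2) :=
  {p | ∃ x : S →₀ Ell2, ∀ χ : Y, p χ = x.sum fun s v => (χ : Dual S) s • v}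

/-- The matrices over `𝒫_T(Y)` that are nonnegative at each point of `Y`. -/
def polyMatrixPos {S : Type u} [CommMonoid S] [StarMul S] (T : Set S) (Y : Set (Dual S)) (m : ℕ) :
    Set (Matrix (Fin m) (Fin m) (polySpace T Y)) :=
  {w | ∀ χ : Y, (Matrix.of fun k l => (w k l : Y → ℂ) χ).PosSemidef}

/-- The matrices over `𝒫_T(Y)` of the form `[⟨p k, p l⟩]` with `p 1, …, p m ∈ 𝒫(Y, ℓ²)`. Here
`⟨x, y⟩` is linear in `x`, so that it is `inner ℂ y x` in Mathlib's convention. -/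
def polyMatrixFact {S : Type u} [CommMonoid S] [StarMul S] (T : Set S) (Y : Set (Dual S)) (m : ℕ) :
    Set (Matrix (Fin m) (Fin m) (polySpace T Y)) :=
  {w | ∃ p : Fin m → Y → Ell2, (∀ k, p k ∈ polySpaceEll2 Y) ∧
    ∀ k l, ∀ χ : Y, (w k l : Y → ℂ) χ = inner ℂ (p l χ) (p k χ)}

/-! ### The linear mapping associated with a form-valued mapping -/

section Lambda

variable {S : Type u} [CommMonoid S] [StarMul S] {T : Set S} {Y : Set (Dual S)}
  {D : Type v} [AddCommGroup D] [Module ℂ D]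

/-- For a determining set `Y`, the linear mapping `Λ_{Φ,Y} : 𝒫_T(Y) → 𝒮(D)` which sends `ŝ|_Y`
to `Φ s` for every `s ∈ T`. -/
def lambdaMap (hY : IsDetermining Y) (Φ : T → SesqForm D) : polySpace T Y →ₗ[ℂ] SesqForm D :=
  (Module.Basis.span (hY.2.comp (Subtype.val : T → S) Subtype.val_injective)).constr ℂ Φ

/-- The defining property of `Λ_{Φ,Y}`. -/
theorem lambdaMap_transform (hY : IsDetermining Y) (Φ : T → SesqForm D) (s : T) :
    lambdaMap hY Φ ⟨transform Y (s : S), Submodule.subset_span ⟨s, rfl⟩⟩ = Φ s := by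
  have h := Module.Basis.constr_basis
    (Module.Basis.span (hY.2.comp (Subtype.val : T → S) Subtype.val_injective)) ℂ Φ s
  rw [Module.Basis.span_apply] at h
  exact h

/-- Complete positivity of a linear mapping `Λ : 𝒫_T(Y) → 𝒮(D)`. -/
def IsCompletelyPositive (Λ : polySpace T Y →ₗ[ℂ] SesqForm D) : Prop :=
  ∀ m : ℕ, ∀ w ∈ polyMatrixPos T Y m, w.map Λ ∈ formMatrixPos D m

/-- Complete f-positivity of a linear mapping `Λ : 𝒫_T(Y) → 𝒮(D)`. -/
def IsCompletelyFPositive (Λ : polySpace T Y →ₗ[ℂ] SesqForm D) : Prop :=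
  ∀ m : ℕ, ∀ w ∈ polyMatrixFact T Y m, w.map Λ ∈ formMatrixPos D m

end Lambda

/-! ### Semispectral measures and operator semiperfectness -/

/-- A semispectral measure: a mapping `μ` from the `σ`-algebra of `X` to the sesquilinear forms on
`D` such that `μ(·)(f, f)` is a finite positive measure for every `f`. As for Mathlib's vector
measures, the value at a set outside the `σ`-algebra is set to be `0`. -/
structure SemispectralMeasure (X : Type u) [MeasurableSpace X] (D : Type v) [AddCommGroup D]
    [Module ℂ D] where
  toForm : Set X → SesqForm D
  not_measurable : ∀ σ : Set X, ¬ MeasurableSet σ → toForm σ = 0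
  exists_measure : ∀ f : D, ∃ ν : Measure X, IsFiniteMeasure ν ∧
    ∀ σ : Set X, MeasurableSet σ → toForm σ f f = ((ν.real σ : ℝ) : ℂ)

namespace SemispectralMeasure

variable {X : Type u} [MeasurableSpace X] {D : Type v} [AddCommGroup D] [Module ℂ D]

theorem polarization (φ : SesqForm D) (f g : D) :
    φ f g = (1 / 4 : ℂ) * (φ (f + g) (f + g) - φ (f - g) (f - g)
      + Complex.I * φ (f + Complex.I • g) (f + Complex.I • g)
      - Complex.I * φ (f - Complex.I • g) (f - Complex.I • g)) := by
  simp only [map_add, map_sub, LinearMap.add_apply, LinearMap.sub_apply, map_smul,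
    LinearMap.map_smulₛₗ, LinearMap.smul_apply, smul_eq_mul, Complex.conj_I]
  linear_combination ((1 / 2 : ℂ) * φ f g - (1 / 2 : ℂ) * φ g f) * Complex.I_sq

theorem hasSum_diag (μ : SemispectralMeasure X D) (f : D) {σ : ℕ → Set X}
    (hm : ∀ i, MeasurableSet (σ i)) (hd : Pairwise (Function.onFun Disjoint σ)) :
    HasSum (fun i => μ.toForm (σ i) f f) (μ.toForm (⋃ i, σ i) f f) := by
  obtain ⟨ν, hν, h⟩ := μ.exists_measure f
  rw [h _ (MeasurableSet.iUnion hm)]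
  have h2 := ν.toSignedMeasure.m_iUnion hm hd
  simp only [Measure.toSignedMeasure_apply_measurable, hm,
    MeasurableSet.iUnion hm] at h2
  simpa only [h _ (hm _)] using Complex.hasSum_ofReal.2 h2

/-- The complex measure `μ(·)(f, g)`. -/
def complexMeasure (μ : SemispectralMeasure X D) (f g : D) : ComplexMeasure X where
  measureOf' σ := μ.toForm σ f g
  empty' := by
    have h : ∀ f, μ.toForm ∅ f f = 0 := fun f => by
      obtain ⟨ν, _, h⟩ := μ.exists_measure f
      simp [h ∅ MeasurableSet.empty]
    rw [polarization]
    simp only [h]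
    ring
  not_measurable' σ hσ := by simp [μ.not_measurable σ hσ]
  m_iUnion' σ hm hd := by
    have h := fun f => μ.hasSum_diag f hm hd
    rw [polarization]
    simp only [fun i => polarization (μ.toForm (σ i)) f g]
    exact ((((h _).sub (h _)).add ((h _).mul_left _)).sub ((h _).mul_left _)).mul_left _

/-- `φ = ∫ F dμ`, that is, for all `f` and `g` the function `F` is summable with respect to the
complex measure `μ(·)(f, g)` (with respect to its total variation) and
`φ (f, g) = ∫ F(x) μ(dx)(f, g)`. -/
def HasIntegral (μ : SemispectralMeasure X D) (F : X → ℂ) (φ : SesqForm D) : Prop :=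
  ∀ f g : D, (μ.complexMeasure f g).Integrable F ∧
    φ f g = (μ.complexMeasure f g).integral F (ContinuousLinearMap.mul ℝ ℂ)

end SemispectralMeasure

/-- Operator semiperfectness: every positive definite mapping into the sesquilinear forms on a
complex linear space `D` is the Laplace transform of a semispectral measure on the dual. -/
def IsOperatorSemiperfect (S : Type u) [CommMonoid S] [StarMul S] : Prop :=
  ∀ (D : Type v) [AddCommGroup D] [Module ℂ D] (Ψ : S → SesqForm D), IsPositiveDefinite Ψ →
    ∃ μ : SemispectralMeasure (Dual S) D, ∀ s : S, μ.HasIntegral (fun χ => χ s) (Ψ s)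

end StarSemigroup

end

open StarSemigroup

/-! The implications run in a cycle, and semiperfectness enters only in passing from a positive
definite extension to a measure.

From a measure to complete positivity: for fixed vectors `h k`, polarization gives all the complex
measures `μ(·)(h k, h l)` densities with respect to one finite measure. The density matrix is almost
everywhere positive (`ae_density_nonneg`), and the entries of its Schur product with a positive
semidefinite matrix have a nonnegative sum (`schur_sum_nonneg`). Integration gives the claim.

From complete positivity to complete f-positivity on `Y`: polynomials on the dual are determined by
their restrictions to `Y`, so a Gram factorization on `Y` holds on the whole dual, and Gram matrices
are positive semidefinite.

From complete f-positivity to an extension (`exists_positive_extension`): in a basis of `D`,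
form-valued linear maps on the `*`-algebra `A` of polynomials on `Y` correspond to functionals on
finitely supported matrices over `A`. The M. Riesz extension theorem applies to the real cone of
matrices `x` with `x + x*` a finite sum of matrices `p p*`. Its cofinality hypothesis holds because
every `star s * s` is Hermitian and so lies in `T`: an entry `z` at `(i, j)` is completed to a
square by diagonal entries `z z* / 2` and `1 / 2`. -/

noncomputable section

namespace StarSemigroup

/-! ### Integration of positive matrices against a semispectral measure. -/

namespace SemispectralMeasure

variable {X : Type u} [MeasurableSpace X] {D : Type v} [AddCommGroup D] [Module ℂ D]

/-- The finite positive measure `μ(·)(f, f)`. -/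
def diagMeasure (μ : SemispectralMeasure X D) (f : D) : Measure X :=
  (μ.exists_measure f).choose

instance (μ : SemispectralMeasure X D) (f : D) : IsFiniteMeasure (μ.diagMeasure f) :=
  (μ.exists_measure f).choose_spec.1

theorem toForm_self (μ : SemispectralMeasure X D) (f : D) {σ : Set X} (hσ : MeasurableSet σ) :
    μ.toForm σ f f = (((μ.diagMeasure f).real σ : ℝ) : ℂ) :=
  (μ.exists_measure f).choose_spec.2 σ hσ

theorem complexMeasure_self_apply (μ : SemispectralMeasure X D) (f : D) {σ : Set X}
    (hσ : MeasurableSet σ) :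
    μ.complexMeasure f f σ = (((μ.diagMeasure f).real σ : ℝ) : ℂ) :=
  μ.toForm_self f hσ

/-- A complex measure with nonnegative values is its own total variation. This reduces the integrals
on the diagonal to ordinary Bochner integrals. -/
theorem variation_complexMeasure_self (μ : SemispectralMeasure X D) (f : D) :
    (μ.complexMeasure f f).variation = μ.diagMeasure f := by
  have key : ∀ s, MeasurableSet s → ‖μ.complexMeasure f f s‖ₑ = μ.diagMeasure f s := by
    intro s hs
    rw [complexMeasure_self_apply μ f hs, ← ofReal_norm, Complex.norm_real,
      Real.norm_of_nonneg measureReal_nonneg, ofReal_measureReal]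
  apply le_antisymm
  · exact VectorMeasure.variation_le_of_forall_enorm_le fun s hs => (key s hs).le
  · exact Measure.le_iff.2 fun s hs =>
      (key s hs).symm.le.trans (VectorMeasure.enorm_measure_le_variation _ _)

theorem integral_complexMeasure_self (μ : SemispectralMeasure X D) (f : D) (F : X → ℂ) :
    (μ.complexMeasure f f).integral F (ContinuousLinearMap.mul ℝ ℂ) =
      ∫ x, F x ∂(μ.diagMeasure f) := by
  have hv := μ.variation_complexMeasure_self f
  have hc : ∀ s, MeasurableSet s → μ.complexMeasure f f s = (((μ.diagMeasure f).real s : ℝ) : ℂ) :=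
    fun s hs => complexMeasure_self_apply μ f hs
  -- With both measures turned into variables, `subst` makes the two integrals live over the same
  -- measure, and only their set functions remain to be compared.
  generalize μ.complexMeasure f f = c at hv hc ⊢
  generalize μ.diagMeasure f = ν at hv hc ⊢
  subst hv
  rw [VectorMeasure.integral_eq_setToFun, integral_eq_setToFun]
  refine setToFun_congr_left' _ _ (fun s hs _ => ?_) F
  ext1 x
  rw [transpose_eq_cbmApplyMeasure, cbmApplyMeasure_apply, hc s hs,
    weightedSMul_apply, ContinuousLinearMap.mul_apply', Complex.real_smul, mul_comm]

/-- The value obtained by polarization from a function on `D`. -/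
def polar (q : D → ℂ) (f g : D) : ℂ :=
  (1 / 4 : ℂ) * (q (f + g) - q (f - g)
      + Complex.I * q (f + Complex.I • g) - Complex.I * q (f - Complex.I • g))

theorem HasIntegral.integrable {μ : SemispectralMeasure X D} {F : X → ℂ} {φ : SesqForm D}
    (h : μ.HasIntegral F φ) (f : D) : Integrable F (μ.diagMeasure f) := by
  have := (h f f).1
  rwa [VectorMeasure.Integrable, variation_complexMeasure_self] at this

theorem HasIntegral.apply_self {μ : SemispectralMeasure X D} {F : X → ℂ} {φ : SesqForm D}
    (h : μ.HasIntegral F φ) (f : D) : φ f f = ∫ x, F x ∂(μ.diagMeasure f) := by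
  rw [(h f f).2, integral_complexMeasure_self]

/-- The sum of the measures which occur in the polarization of `μ(·)(h k, h l)`. -/
def polarMeasure (μ : SemispectralMeasure X D) {m : ℕ} (h : Fin m → D) : Measure X :=
  ∑ k, ∑ l, (μ.diagMeasure (h k + h l) + μ.diagMeasure (h k - h l)
    + μ.diagMeasure (h k + Complex.I • h l) + μ.diagMeasure (h k - Complex.I • h l))

instance (μ : SemispectralMeasure X D) {m : ℕ} (h : Fin m → D) :
    IsFiniteMeasure (μ.polarMeasure h) := by
  unfold polarMeasure; infer_instance

/-- The density of `μ(·)(f, f)`, as a complex function. -/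
def diagDensity (μ : SemispectralMeasure X D) (ν : Measure X) (f : D) (x : X) : ℂ :=
  (((μ.diagMeasure f).rnDeriv ν x).toReal : ℂ)

theorem polarMeasure_ge (μ : SemispectralMeasure X D) {m : ℕ} (h : Fin m → D) (k l : Fin m) :
    (μ.diagMeasure (h k + h l) + μ.diagMeasure (h k - h l)
    + μ.diagMeasure (h k + Complex.I • h l) + μ.diagMeasure (h k - Complex.I • h l))
      ≤ μ.polarMeasure h := by
  refine le_trans ?_ (Finset.single_le_sum (f := fun k => ∑ l, (μ.diagMeasure (h k + h l) +
    μ.diagMeasure (h k - h l) + μ.diagMeasure (h k + Complex.I • h l) +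
    μ.diagMeasure (h k - Complex.I • h l))) (fun _ _ => Measure.zero_le _) (Finset.mem_univ k))
  exact (Finset.single_le_sum (f := fun l => (μ.diagMeasure (h k + h l) +
    μ.diagMeasure (h k - h l) + μ.diagMeasure (h k + Complex.I • h l) +
    μ.diagMeasure (h k - Complex.I • h l))) (fun _ _ => Measure.zero_le _) (Finset.mem_univ l))

theorem polarMeasure_ac (μ : SemispectralMeasure X D) {m : ℕ} (h : Fin m → D) (k l : Fin m) :
    μ.diagMeasure (h k + h l) ≪ μ.polarMeasure h ∧
    μ.diagMeasure (h k - h l) ≪ μ.polarMeasure h ∧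
    μ.diagMeasure (h k + Complex.I • h l) ≪ μ.polarMeasure h ∧
    μ.diagMeasure (h k - Complex.I • h l) ≪ μ.polarMeasure h := by
  have h0 := (μ.polarMeasure_ge h k l).absolutelyContinuous
  have h1 := (Measure.AbsolutelyContinuous.add_left_iff.1 h0)
  have h2 := (Measure.AbsolutelyContinuous.add_left_iff.1 h1.1)
  have h3 := (Measure.AbsolutelyContinuous.add_left_iff.1 h2.1)
  exact ⟨h3.1, h3.2, h2.2, h1.2⟩

section density

variable {μ : SemispectralMeasure X D} {ν : Measure X} [IsFiniteMeasure ν] {f : D}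

theorem integrable_mul_diagDensity (hf : μ.diagMeasure f ≪ ν) {F : X → ℂ}
    (hF : Integrable F (μ.diagMeasure f)) :
    Integrable (fun x => F x * μ.diagDensity ν f x) ν := by
  have := (integrable_rnDeriv_smul_iff hf (E := ℂ) (f := F)).2 hF
  refine this.congr (.of_forall fun x => ?_)
  simp [diagDensity, Complex.real_smul, mul_comm]

theorem integral_mul_diagDensity (hf : μ.diagMeasure f ≪ ν) (F : X → ℂ) :
    ∫ x, F x * μ.diagDensity ν f x ∂ν = ∫ x, F x ∂(μ.diagMeasure f) := by
  rw [← integral_rnDeriv_smul hf]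
  refine integral_congr_ae (.of_forall fun x => ?_)
  simp [diagDensity, Complex.real_smul, mul_comm]

end density

/-- The polarized densities act as the density of `μ(·)(h k, h l)`: polarization is a fixed linear
combination of four diagonal terms, each dominated by `polarMeasure`. -/
theorem polar_integral (μ : SemispectralMeasure X D) {m : ℕ} (h : Fin m → D) (k l : Fin m)
    {F : X → ℂ} (hF : ∀ f, Integrable F (μ.diagMeasure f)) :
    Integrable (fun x => F x * polar (fun f => μ.diagDensity (μ.polarMeasure h) f x) (h k) (h l))
      (μ.polarMeasure h) ∧
    ∫ x, F x * polar (fun f => μ.diagDensity (μ.polarMeasure h) f x) (h k) (h l)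
      ∂(μ.polarMeasure h) = polar (fun f => ∫ x, F x ∂(μ.diagMeasure f)) (h k) (h l) := by
  obtain ⟨h1, h2, h3, h4⟩ := μ.polarMeasure_ac h k l
  have e : (fun x => F x * polar (fun f => μ.diagDensity (μ.polarMeasure h) f x) (h k) (h l)) =
      fun x => (1 / 4 : ℂ) * (F x * μ.diagDensity (μ.polarMeasure h) (h k + h l) x
        - F x * μ.diagDensity (μ.polarMeasure h) (h k - h l) x
        + Complex.I * (F x * μ.diagDensity (μ.polarMeasure h) (h k + Complex.I • h l) x)
        - Complex.I * (F x * μ.diagDensity (μ.polarMeasure h) (h k - Complex.I • h l) x)) := by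
    funext x; simp only [polar]; ring
  have i1 := integrable_mul_diagDensity h1 (hF _)
  have i2 := integrable_mul_diagDensity h2 (hF _)
  have i3 := (integrable_mul_diagDensity h3 (hF _)).const_mul Complex.I
  have i4 := (integrable_mul_diagDensity h4 (hF _)).const_mul Complex.I
  rw [e]
  refine ⟨(((i1.sub i2).add i3).sub i4).const_mul _, ?_⟩
  have j1 := integral_sub i1 i2
  have j2 := integral_add (i1.sub i2) i3
  have j3 := integral_sub ((i1.sub i2).add i3) i4
  simp only [Pi.add_apply, Pi.sub_apply] at j1 j2 j3
  rw [integral_const_mul, j3, j2, j1, integral_const_mul, integral_const_mul, integral_mul_diagDensity h1,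
    integral_mul_diagDensity h2, integral_mul_diagDensity h3, integral_mul_diagDensity h4, polar]

theorem ae_nonneg_of_setIntegral_nonneg {ν : Measure X} {q : X → ℂ} (hq : Integrable q ν)
    (h : ∀ s, MeasurableSet s → 0 ≤ ∫ x in s, q x ∂ν) : ∀ᵐ x ∂ν, 0 ≤ q x := by
  have hre : 0 ≤ᵐ[ν] fun x => (q x).re :=
    ae_nonneg_of_forall_setIntegral_nonneg hq.re fun s hs _ => by
      have := Complex.reCLM.integral_comp_comm hq.integrableOn (μ := ν.restrict s)
      simp only [Complex.reCLM_apply] at this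
      exact this ▸ (Complex.le_def.1 (h s hs)).1
  have him : (fun x => (q x).im) =ᵐ[ν] 0 :=
    hq.im.ae_eq_zero_of_forall_setIntegral_eq_zero fun s hs _ => by
      have := Complex.imCLM.integral_comp_comm hq.integrableOn (μ := ν.restrict s)
      simp only [Complex.imCLM_apply] at this
      exact this.trans (Complex.le_def.1 (h s hs)).2.symm
  filter_upwards [hre, him] with x h1 h2
  exact Complex.le_def.2 ⟨h1, h2.symm⟩

/-- Over a measurable set `s` the expression integrates to `μ(s)(v, v) ≥ 0` with `v = ∑ c k • h k`.
At a single point `x` the polarized densities need not be sesquilinear in the vectors, so positivity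
is expressed through the coefficients `c`. -/
theorem ae_density_nonneg (μ : SemispectralMeasure X D) {m : ℕ} (h : Fin m → D) :
    ∀ᵐ x ∂(μ.polarMeasure h), ∀ c : Fin m → ℂ, 0 ≤ ∑ k, ∑ l, c k * conj (c l) *
      polar (fun f => μ.diagDensity (μ.polarMeasure h) f x) (h k) (h l) := by
  have hc : ∀ c : Fin m → ℂ, ∀ᵐ x ∂(μ.polarMeasure h), 0 ≤ ∑ k, ∑ l, c k * conj (c l) *
      polar (fun f => μ.diagDensity (μ.polarMeasure h) f x) (h k) (h l) := by
    intro c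
    have hi : ∀ k l, Integrable (fun x => c k * conj (c l) *
        polar (fun f => μ.diagDensity (μ.polarMeasure h) f x) (h k) (h l))
        (μ.polarMeasure h) := fun k l =>
      (μ.polar_integral h k l (F := fun _ => c k * conj (c l)) fun f => integrable_const _).1
    refine ae_nonneg_of_setIntegral_nonneg
      (integrable_finsetSum _ fun k _ => integrable_finsetSum _ fun l _ => hi k l) fun s hs => ?_
    have hs' : ∀ k l, ∫ x in s, c k * conj (c l) *
        polar (fun f => μ.diagDensity (μ.polarMeasure h) f x) (h k) (h l) ∂(μ.polarMeasure h) =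
        c k * conj (c l) * μ.toForm s (h k) (h l) := by
      intro k l
      -- Testing against the indicator of `s` recovers `μ(s)(h k, h l)`.
      have hI : ∀ f, Integrable (s.indicator fun _ => (1 : ℂ)) (μ.diagMeasure f) := fun f =>
        (integrable_const _).indicator hs
      have := (μ.polar_integral h k l hI).2
      rw [integral_const_mul, polarization, ← integral_indicator hs]
      congr 1
      have e : (fun f => ∫ x, s.indicator (fun _ => (1 : ℂ)) x ∂(μ.diagMeasure f)) =
          fun f => μ.toForm s f f := by
        funext f
        rw [integral_indicator hs, toForm_self _ _ hs]
        simp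
      rw [e, polar] at this
      rw [← this]
      refine integral_congr_ae (.of_forall fun x => ?_)
      by_cases hx : x ∈ s <;> simp [hx]
    rw [integral_finsetSum _ fun k _ => integrable_finsetSum _ fun l _ => (hi k l).integrableOn]
    have : ∑ k, ∫ x in s, ∑ l, c k * conj (c l) *
        polar (fun f => μ.diagDensity (μ.polarMeasure h) f x) (h k) (h l) ∂(μ.polarMeasure h) =
        μ.toForm s (∑ k, c k • h k) (∑ l, c l • h l) := by
      simp only [map_sum, LinearMap.sum_apply, map_smul, LinearMap.map_smulₛₗ,
        LinearMap.smul_apply, smul_eq_mul]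
      simp only [Finset.mul_sum]
      rw [Finset.sum_comm]
      refine Finset.sum_congr rfl fun k _ => ?_
      rw [integral_finsetSum _ fun l _ => (hi k l).integrableOn]
      refine Finset.sum_congr rfl fun l _ => ?_
      rw [hs']; ring
    rw [this, toForm_self _ _ hs]
    exact_mod_cast measureReal_nonneg
  -- The null set depends on `c`. A countable dense family gives a common one, and the inequality is
  -- a closed condition on `c`.
  have hd := ae_all_iff.2 fun n => hc (TopologicalSpace.denseSeq (Fin m → ℂ) n)
  filter_upwards [hd] with x hx c
  refine (TopologicalSpace.denseRange_denseSeq (Fin m → ℂ)).induction_on (p := fun c =>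
    0 ≤ ∑ k, ∑ l, c k * conj (c l) *
      polar (fun f => μ.diagDensity (μ.polarMeasure h) f x) (h k) (h l)) c ?_ hx
  exact isClosed_le continuous_const (by fun_prop)

-- Writing `w = B* B` splits the sum over the rows `r` of `B` into values of the form `d` at the
-- coefficients `conj (B r k)`.
open scoped MatrixOrder in
theorem schur_sum_nonneg {m : ℕ} {w : Matrix (Fin m) (Fin m) ℂ} (hw : w.PosSemidef)
    {d : Fin m → Fin m → ℂ} (hd : ∀ c : Fin m → ℂ, 0 ≤ ∑ k, ∑ l, c k * conj (c l) * d k l) :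
    0 ≤ ∑ k, ∑ l, w k l * d k l := by
  obtain ⟨B, rfl⟩ : ∃ B : Matrix (Fin m) (Fin m) ℂ, w = B.conjTranspose * B := by
    refine ⟨CFC.sqrt w, ?_⟩
    rw [(Matrix.nonneg_iff_posSemidef.1 (CFC.sqrt_nonneg w)).isHermitian.eq, CFC.sqrt_mul_sqrt_self w hw.nonneg]
  have : ∑ k, ∑ l, (B.conjTranspose * B) k l * d k l =
      ∑ r, ∑ k, ∑ l, conj (B r k) * conj (conj (B r l)) * d k l := by
    simp only [Matrix.mul_apply, Finset.sum_mul, Matrix.conjTranspose_apply, RCLike.star_def,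
      Complex.conj_conj]
    rw [Finset.sum_comm]
    refine (Finset.sum_congr rfl fun k _ => Finset.sum_comm).trans ?_
    rw [Finset.sum_comm]
    exact Finset.sum_congr rfl fun r _ => Finset.sum_comm
  rw [this]
  exact Finset.sum_nonneg fun r _ => hd _

/-- Integration of pointwise nonnegative matrices against a semispectral measure. -/
theorem sum_polar_integral_nonneg (μ : SemispectralMeasure X D) {m : ℕ} (h : Fin m → D)
    {w : Fin m → Fin m → X → ℂ} (hi : ∀ k l f, Integrable (w k l) (μ.diagMeasure f))
    (hw : ∀ x, (Matrix.of fun k l => w k l x).PosSemidef) :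
    0 ≤ ∑ k, ∑ l, polar (fun f => ∫ x, w k l x ∂(μ.diagMeasure f)) (h k) (h l) := by
  have h1 := fun k l => μ.polar_integral h k l (hi k l)
  simp only [← fun k l => (h1 k l).2]
  have e : ∀ k, ∑ l, ∫ x, w k l x * polar (fun f => μ.diagDensity (μ.polarMeasure h) f x)
      (h k) (h l) ∂(μ.polarMeasure h) = ∫ x, ∑ l, w k l x *
        polar (fun f => μ.diagDensity (μ.polarMeasure h) f x) (h k) (h l)
        ∂(μ.polarMeasure h) := fun k =>
    (integral_finsetSum _ fun l _ => (h1 k l).1).symm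
  simp only [e]
  rw [← integral_finsetSum _ fun k _ => integrable_finsetSum _ fun l _ => (h1 k l).1]
  refine integral_nonneg_of_ae ?_
  filter_upwards [μ.ae_density_nonneg h] with x hx
  exact schur_sum_nonneg (hw x) hx

end SemispectralMeasure

/-! ### Riesz extension of positive form-valued mappings. -/

/-- One entry of the expansion of `(z e_i + e_j)(z e_i + e_j)*`. The propositions say whether the
row index (`P`, `R`) and the column index (`P'`, `R'`) equal `i` or `j`; they are independent, so `i
= j` is covered. -/
theorem ite_gram {A : Type u} [CommRing A] [StarRing A] {s q z : A} (e1 : s + star s = 1) (e2 : q + star q = z * star z)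
    {P P' R R' : Prop} [Decidable P] [Decidable P'] [Decidable R] [Decidable R'] :
    (((if P ∧ P' then q else 0) + if R ∧ R' then s else 0) + if P ∧ R' then z else 0) +
      ((star (if P' ∧ P then q else 0) + star (if R' ∧ R then s else 0)) +
        star (if P' ∧ R then z else 0)) =
    ((if P then z else 0) + if R then 1 else 0) *
      (star (if P' then z else 0) + star (if R' then 1 else 0)) := by
  by_cases h1 : P <;> by_cases h2 : P' <;> by_cases h3 : R <;> by_cases h4 : R' <;>
    simp [h1, h2, h3, h4] <;>
    first
    | linear_combination e1
    | linear_combination e2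
    | linear_combination e1 + e2

section Extension

variable {A : Type u} [CommRing A] [Algebra ℂ A]
  {D : Type v} [AddCommGroup D] [Module ℂ D] {ι : Type v}

/-- The matrix `[f i * conj (g j) • a]`. -/
def coordMatrix (b : Module.Basis ι ℂ D) (a : A) (f g : D) : (ι × ι) →₀ A :=
  Finsupp.onFinset ((b.repr f).support ×ˢ (b.repr g).support)
    (fun ij => (b.repr f ij.1 * conj (b.repr g ij.2)) • a) fun ij h => by
      simp only [Finset.mem_product, Finsupp.mem_support_iff]
      constructor <;> intro h0 <;> simp [h0] at h

theorem coordMatrix_apply (b : Module.Basis ι ℂ D) (a : A) (f g : D) (i j : ι) :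
    coordMatrix b a f g (i, j) = (b.repr f i * conj (b.repr g j)) • a := rfl

theorem coordMatrix_basis (b : Module.Basis ι ℂ D) (a : A) (i j : ι) :
    coordMatrix b a (b i) (b j) = Finsupp.single (i, j) a := by
  classical
  ext ⟨k, l⟩
  rw [coordMatrix_apply]
  simp only [Module.Basis.repr_self, Finsupp.single_apply, Prod.mk.injEq]
  by_cases h1 : i = k <;> by_cases h2 : j = l <;> simp [h1, h2]

/-- The form-valued linear mapping determined by a linear functional on matrices. -/
def formOfFunctional (b : Module.Basis ι ℂ D) (F : ((ι × ι) →₀ A) →ₗ[ℂ] ℂ) :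
    A →ₗ[ℂ] SesqForm D where
  toFun a := LinearMap.mk₂'ₛₗ (RingHom.id ℂ) (starRingEnd ℂ) (fun f g => F (coordMatrix b a f g))
    (fun f f' g => by
      rw [← map_add]; congr 1; ext ⟨i, j⟩
      simp only [coordMatrix_apply, Finsupp.add_apply, map_add, add_mul, add_smul])
    (fun c f g => by
      rw [RingHom.id_apply, ← map_smul]; congr 1; ext ⟨i, j⟩
      simp only [coordMatrix_apply, Finsupp.smul_apply, map_smul, smul_smul, smul_eq_mul, mul_assoc])
    (fun f g g' => by
      rw [← map_add]; congr 1; ext ⟨i, j⟩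
      simp only [coordMatrix_apply, Finsupp.add_apply, map_add, mul_add, add_smul])
    (fun c f g => by
      rw [← map_smul]; congr 1; ext ⟨i, j⟩
      simp only [coordMatrix_apply, Finsupp.smul_apply, map_smul, smul_smul, smul_eq_mul, map_mul]
      congr 1; ring)
  map_add' a a' := by
    ext f g
    simp only [LinearMap.mk₂'ₛₗ_apply, LinearMap.add_apply]
    rw [← map_add]; congr 1; ext ⟨i, j⟩
    simp only [coordMatrix_apply, Finsupp.add_apply, smul_add]
  map_smul' c a := by
    ext f g
    simp only [LinearMap.mk₂'ₛₗ_apply, LinearMap.smul_apply, RingHom.id_apply]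
    rw [← map_smul]; congr 1; ext ⟨i, j⟩
    simp only [coordMatrix_apply, Finsupp.smul_apply, smul_smul, mul_comm c]

theorem formOfFunctional_apply (b : Module.Basis ι ℂ D) (F : ((ι × ι) →₀ A) →ₗ[ℂ] ℂ) (a : A)
    (f g : D) : formOfFunctional b F a f g = F (coordMatrix b a f g) := rfl

/-- The linear functional on matrices determined by a form-valued linear mapping. -/
def functionalOfForm (b : Module.Basis ι ℂ D) (Λ : A →ₗ[ℂ] SesqForm D) :
    ((ι × ι) →₀ A) →ₗ[ℂ] ℂ :=
  Finsupp.lsum ℂ fun ij : ι × ι =>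
    { toFun := fun a => Λ a (b ij.1) (b ij.2)
      map_add' := fun x y => by simp
      map_smul' := fun c x => by simp }

theorem functionalOfForm_single (b : Module.Basis ι ℂ D) (Λ : A →ₗ[ℂ] SesqForm D) (i j : ι)
    (a : A) : functionalOfForm b Λ (Finsupp.single (i, j) a) = Λ a (b i) (b j) := by
  simp [functionalOfForm]

theorem functionalOfForm_eq_sum [DecidableEq ι] (b : Module.Basis ι ℂ D) (Λ : A →ₗ[ℂ] SesqForm D)
    (x : (ι × ι) →₀ A) {J : Finset ι} (hJ : x.support ⊆ J ×ˢ J) :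
    functionalOfForm b Λ x = ∑ i ∈ J, ∑ j ∈ J, Λ (x (i, j)) (b i) (b j) := by
  rw [← Finset.sum_product' J J fun i j => Λ (x (i, j)) (b i) (b j)]
  rw [functionalOfForm, Finsupp.lsum_apply, Finsupp.sum_of_support_subset _ hJ]
  · rfl
  · intro ij _
    exact map_zero _

/-- The finitely supported matrices over `A` whose sum with their adjoint is a finite sum of
matrices `[p i * star (p j)]`. -/
def gramCone (A : Type u) [CommRing A] [StarRing A] [Algebra ℂ A] [StarModule ℂ A] (ι : Type v) :
    PointedCone ℝ ((ι × ι) →₀ A) where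
  -- The condition bears on `x + x*` and not on `x`, so skew-adjoint matrices belong to the cone
  -- with both signs and every positive functional vanishes on them.
  carrier := {x | ∃ (n : ℕ) (p : Fin n → ι → A),
    ∀ i j, x (i, j) + star (x (j, i)) = ∑ r, p r i * star (p r j)}
  zero_mem' := ⟨0, Fin.elim0, by simp⟩
  add_mem' := by
    rintro x y ⟨n, p, hp⟩ ⟨n', p', hp'⟩
    refine ⟨n + n', Fin.append p p', fun i j => ?_⟩
    rw [Fin.sum_univ_add]
    simp only [Fin.append_left, Fin.append_right, ← hp, ← hp', Finsupp.add_apply, star_add]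
    ring
  smul_mem' := by
    rintro c x ⟨n, p, hp⟩
    refine ⟨n, fun r i => ((Real.sqrt c : ℝ) : ℂ) • p r i, fun i j => ?_⟩
    have h1 : ∀ ij, (c • x) ij = ((c : ℝ) : ℂ) • x ij := fun _ => rfl
    have h2 : (((Real.sqrt c : ℝ) : ℂ)) * (Real.sqrt c : ℝ) = ((c : ℝ) : ℂ) := by
      rw [← Complex.ofReal_mul, Real.mul_self_sqrt c.2]
    simp only [h1, star_smul, RCLike.star_def, Complex.conj_ofReal, smul_mul_smul_comm, h2,
      ← Finset.smul_sum, ← hp, smul_add]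

variable [StarRing A] [StarModule ℂ A]

/-- Expanding `(1 + c a)(1 + c a)*` for `|c| = 1` shows that `c Λ(a) + conj c Λ(a*)` is real on the
diagonal. The choices `c = 1` and `c = I` give the diagonal identity, and polarization gives the
rest. -/
theorem star_apply_of_sq_nonneg {Λ : A →ₗ[ℂ] SesqForm D} {B : Submodule ℂ A}
    (hpos : ∀ a : A, a * star a ∈ B → ∀ f, 0 ≤ Λ (a * star a) f f) (hone : 1 ∈ B) {a : A}
    (ha : a ∈ B) (ha' : star a ∈ B) (haa : a * star a ∈ B) (f g : D) :
    Λ (star a) g f = conj (Λ a f g) := by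
  have hdiag : ∀ f, Λ (star a) f f = conj (Λ a f f) := by
    intro f
    have h1 := (Complex.le_def.1 (hpos 1 (by simpa using hone) f)).2
    have h2 := (Complex.le_def.1 (hpos a haa f)).2
    have hc : ∀ c : ℂ, c * conj c = 1 → (c * Λ a f f + conj c * Λ (star a) f f).im = 0 := by
      intro c hc
      have e : (1 + c • a) * star (1 + c • a) = 1 + c • a + conj c • star a + a * star a := by
        have : a * star a = (c * conj c) • (a * star a) := by rw [hc, one_smul]
        rw [this]
        simp only [star_add, star_one, star_smul, RCLike.star_def, add_mul, mul_add, one_mul,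
          mul_one, smul_mul_smul_comm]
        ring
      have h3 := hpos (1 + c • a) (by
        rw [e]
        exact B.add_mem (B.add_mem (B.add_mem hone (B.smul_mem _ ha)) (B.smul_mem _ ha')) haa) f
      rw [e] at h3
      have h4 := (Complex.le_def.1 h3).2
      simp only [star_one, mul_one] at h1
      simp only [map_add, map_smul, LinearMap.add_apply, LinearMap.smul_apply, smul_eq_mul,
        Complex.add_im, Complex.zero_im] at h1 h2 h4 ⊢
      linarith
    have h5 := hc 1 (by simp)
    have h6 := hc Complex.I (by simp)
    simp at h5 h6
    apply Complex.ext
    · rw [Complex.conj_re]; linarith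
    · rw [Complex.conj_im]; linarith
  have h1 := hdiag (f + g)
  have h2 := hdiag (f + Complex.I • g)
  simp only [map_add, LinearMap.add_apply, map_smul, LinearMap.map_smulₛₗ, LinearMap.smul_apply,
    smul_eq_mul, Complex.conj_I, map_mul, map_neg, hdiag f, hdiag g] at h1 h2
  linear_combination (1 / 2 : ℂ) * h1 - (Complex.I / 2) * h2 +
    ((1 / 2 : ℂ) * Λ (star a) g f - (1 / 2 : ℂ) * Λ (star a) f g - (1 / 2 : ℂ) * conj (Λ a f g)
      + (1 / 2 : ℂ) * conj (Λ a g f)) * Complex.I_sq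

/-- The positivity hypothesis of the Riesz theorem. By Hermitian symmetry, twice the real part of
the functional at `x` is its value at `x + x*`, which is a sum of squares with entries in `B`. -/
theorem re_functionalOfForm_nonneg (b : Module.Basis ι ℂ D) {Λ : A →ₗ[ℂ] SesqForm D}
    {B : Submodule ℂ A} (hstar : ∀ a ∈ B, star a ∈ B)
    (hherm : ∀ a ∈ B, ∀ f g, Λ (star a) g f = conj (Λ a f g))
    (hpos : ∀ (m n : ℕ) (p : Fin n → Fin m → A), (∀ k l, ∑ r, p r k * star (p r l) ∈ B) →
      ∀ h : Fin m → D, 0 ≤ ∑ k, ∑ l, Λ (∑ r, p r k * star (p r l)) (h k) (h l))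
    {x : (ι × ι) →₀ A} (hxB : ∀ ij, x ij ∈ B) (hx : x ∈ gramCone A ι) :
    0 ≤ (functionalOfForm b Λ x).re := by
  classical
  obtain ⟨n, p, hp⟩ := hx
  set J : Finset ι := x.support.image Prod.fst ∪ x.support.image Prod.snd
  have hJ : x.support ⊆ J ×ˢ J := by
    intro ij hij
    rw [Finset.mem_product]
    exact ⟨Finset.mem_union_left _ (Finset.mem_image_of_mem _ hij),
      Finset.mem_union_right _ (Finset.mem_image_of_mem _ hij)⟩
  have hs := functionalOfForm_eq_sum b Λ x hJ
  have hc : conj (functionalOfForm b Λ x) =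
      ∑ i ∈ J, ∑ j ∈ J, Λ (star (x (j, i))) (b i) (b j) := by
    rw [hs, Finset.sum_comm, map_sum]
    refine Finset.sum_congr rfl fun i _ => ?_
    rw [map_sum]
    refine Finset.sum_congr rfl fun j _ => ?_
    rw [hherm _ (hxB _)]
  have hsum : functionalOfForm b Λ x + conj (functionalOfForm b Λ x) =
      ∑ i ∈ J, ∑ j ∈ J, Λ (∑ r, p r i * star (p r j)) (b i) (b j) := by
    rw [hc, hs, ← Finset.sum_add_distrib]
    refine Finset.sum_congr rfl fun i _ => ?_
    rw [← Finset.sum_add_distrib]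
    refine Finset.sum_congr rfl fun j _ => ?_
    rw [← hp, map_add]; rfl
  have hge : 0 ≤ ∑ i ∈ J, ∑ j ∈ J, Λ (∑ r, p r i * star (p r j)) (b i) (b j) := by
    let e := J.equivFin
    have := hpos J.card n (fun r k => p r (e.symm k))
      (fun k l => by rw [← hp]; exact B.add_mem (hxB _) (hstar _ (hxB _)))
      (fun k => b (e.symm k))
    rw [e.symm.sum_comp (fun i : J => ∑ l, Λ (∑ r, p r i * star (p r (e.symm l))) (b i)
      (b (e.symm l)))] at this
    simp only [fun i : J => e.symm.sum_comp (fun j : J => Λ (∑ r, p r i * star (p r j)) (b i)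
      (b j))] at this
    rw [← Finset.sum_coe_sort J]
    simpa only [← Finset.sum_coe_sort J] using this
  rw [← hsum, Complex.add_conj] at hge
  have := (Complex.le_def.1 hge).1
  simp at this
  exact this

/-- The cofinality hypothesis of the Riesz theorem. It reduces to one matrix entry that is a scalar
multiple of an element of `G`. -/
theorem exists_add_mem_gramCone {B : Submodule ℂ A} {G : Set A} (hG : Submodule.span ℂ G = ⊤)
    (hone : 1 ∈ B) (hGB : ∀ g ∈ G, g * star g ∈ B) (y : (ι × ι) →₀ A) :
    ∃ x : (ι × ι) →₀ A, (∀ ij, x ij ∈ B) ∧ x + y ∈ gramCone A ι := by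
  classical
  have hadd : ∀ y z : (ι × ι) →₀ A,
      (∃ x : (ι × ι) →₀ A, (∀ ij, x ij ∈ B) ∧ x + y ∈ gramCone A ι) →
      (∃ x : (ι × ι) →₀ A, (∀ ij, x ij ∈ B) ∧ x + z ∈ gramCone A ι) →
      ∃ x : (ι × ι) →₀ A, (∀ ij, x ij ∈ B) ∧ x + (y + z) ∈ gramCone A ι := by
    rintro y z ⟨x, hx, hxy⟩ ⟨x', hx', hxz⟩
    refine ⟨x + x', fun ij => B.add_mem (hx ij) (hx' ij), ?_⟩
    rw [add_add_add_comm]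
    exact add_mem hxy hxz
  have hzero : ∃ x : (ι × ι) →₀ A, (∀ ij, x ij ∈ B) ∧ x + 0 ∈ gramCone A ι :=
    ⟨0, fun _ => B.zero_mem, by simp⟩
  induction y using Finsupp.induction_linear with
  | zero => exact hzero
  | add y z hy hz => exact hadd y z hy hz
  | single ij a =>
    obtain ⟨i, j⟩ := ij
    have ha : a ∈ Submodule.span ℂ G := hG ▸ Submodule.mem_top
    -- The cone is only a real one, so complex scalars must be carried through the span induction.
    suffices h : ∀ c : ℂ, ∃ x : (ι × ι) →₀ A, (∀ ij, x ij ∈ B) ∧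
        x + Finsupp.single (i, j) (c • a) ∈ gramCone A ι by simpa using h 1
    induction ha using Submodule.span_induction with
    | zero => simpa using hzero
    | add a a' _ _ ha ha' =>
      intro c
      rw [smul_add, Finsupp.single_add]
      exact hadd _ _ (ha c) (ha' c)
    | smul d a _ ha =>
      intro c
      rw [smul_smul]
      exact ha (c * d)
    | mem a ha =>
      intro c
      -- With `z = c • a`, the diagonal entries `z z* / 2` and `1 / 2` make the sum with the adjoint
      -- equal to the single square of `z e_i + e_j`.
      refine ⟨Finsupp.single (i, i) (((1 / 2 : ℂ) * (c * conj c)) • (a * star a)) +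
        Finsupp.single (j, j) ((1 / 2 : ℂ) • (1 : A)), fun kl => ?_, 1,
        fun _ => Pi.single i (c • a) + Pi.single j 1, fun k l => ?_⟩
      · refine B.add_mem ?_ ?_
        · rw [Finsupp.single_apply]
          split_ifs
          exacts [B.smul_mem _ (hGB a ha), B.zero_mem]
        · rw [Finsupp.single_apply]
          split_ifs
          exacts [B.smul_mem _ hone, B.zero_mem]
      · have e1 : ((1 / 2 : ℂ) • (1 : A)) + star ((1 / 2 : ℂ) • (1 : A)) = 1 := by
          rw [star_smul, star_one, ← add_smul]; norm_num
        have e2 : ((1 / 2 : ℂ) * (c * conj c)) • (a * star a) +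
            star (((1 / 2 : ℂ) * (c * conj c)) • (a * star a)) = (c • a) * star (c • a) := by
          rw [star_smul, star_mul a, star_star a, ← add_smul, star_smul, smul_mul_smul_comm]
          congr 1
          simp only [RCLike.star_def, map_mul, Complex.conj_conj, map_div₀, map_one, map_ofNat]
          ring
        generalize ((1 / 2 : ℂ) • (1 : A)) = s at e1
        generalize ((1 / 2 : ℂ) * (c * conj c)) • (a * star a) = q at e2
        generalize c • a = z at e2
        simp only [Finset.univ_unique, Finset.sum_singleton, Finsupp.add_apply,
          Finsupp.single_apply, Prod.mk.injEq, Pi.add_apply, Pi.single_apply, star_add,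
          eq_comm (b := k), eq_comm (b := l)]
        exact ite_gram e1 e2

/-- Extension of form-valued mappings which are positive on the matrices of squares over a
subspace `B` of a commutative `*`-algebra. -/
theorem exists_positive_extension {B : Submodule ℂ A} (hstar : ∀ a ∈ B, star a ∈ B) {G : Set A}
    (hG : Submodule.span ℂ G = ⊤) (hone : 1 ∈ B) (hGB : ∀ g ∈ G, g * star g ∈ B)
    (hB : B ≤ Submodule.span ℂ {a | a ∈ B ∧ a * star a ∈ B}) (Λ : A →ₗ[ℂ] SesqForm D)
    (hpos : ∀ (m n : ℕ) (p : Fin n → Fin m → A), (∀ k l, ∑ r, p r k * star (p r l) ∈ B) →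
      ∀ h : Fin m → D, 0 ≤ ∑ k, ∑ l, Λ (∑ r, p r k * star (p r l)) (h k) (h l)) :
    ∃ Ψ : A →ₗ[ℂ] SesqForm D, (∀ a ∈ B, Ψ a = Λ a) ∧
      ∀ (m : ℕ) (a : Fin m → A) (h : Fin m → D),
        0 ≤ ∑ k, ∑ l, Ψ (a k * star (a l)) (h k) (h l) := by
  have hherm : ∀ a ∈ B, ∀ f g, Λ (star a) g f = conj (Λ a f g) := by
    intro a ha
    have hsq : ∀ a : A, a * star a ∈ B → ∀ f, 0 ≤ Λ (a * star a) f f := fun a ha f => by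
      simpa using hpos 1 1 (fun _ _ => a) (by simpa using ha) fun _ => f
    have hspan := hB ha
    clear ha
    induction hspan using Submodule.span_induction with
    | mem a ha => exact star_apply_of_sq_nonneg hsq hone ha.1 (hstar a ha.1) ha.2
    | zero => simp
    | add a a' _ _ h h' =>
      intro f g
      simp only [star_add, map_add, LinearMap.add_apply, h, h']
    | smul c a _ h =>
      intro f g
      simp only [star_smul, map_smul, LinearMap.smul_apply, smul_eq_mul, map_mul, h, RCLike.star_def]
  obtain ⟨ι, ⟨b⟩⟩ : ∃ ι : Type v, Nonempty (Module.Basis ι ℂ D) :=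
    ⟨_, ⟨Module.Basis.ofVectorSpace ℂ D⟩⟩
  let EB : Submodule ℂ ((ι × ι) →₀ A) :=
    { carrier := {x | ∀ ij, x ij ∈ B}
      zero_mem' := fun _ => B.zero_mem
      add_mem' := fun hx hy ij => B.add_mem (hx ij) (hy ij)
      smul_mem' := fun c _ hx ij => B.smul_mem c (hx ij) }
  let L := functionalOfForm b Λ
  let f : ((ι × ι) →₀ A) →ₗ.[ℝ] ℝ :=
    ⟨EB.restrictScalars ℝ, (Complex.reLm ∘ₗ L.restrictScalars ℝ).domRestrict _⟩
  obtain ⟨g, hg, hgpos⟩ := riesz_extension (gramCone A ι) f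
    (fun x hx => re_functionalOfForm_nonneg b hstar hherm hpos x.2 hx)
    (fun y => by
      obtain ⟨x, hx, hxy⟩ := exists_add_mem_gramCone (ι := ι) hG hone hGB y
      exact ⟨⟨x, hx⟩, hxy⟩)
  have hg' : ∀ x ∈ EB, g x = (L x).re := fun x hx => hg ⟨x, hx⟩
  -- The complex functional with real part `g`. It agrees with `L` on `EB`, since `EB` is a complex
  -- subspace and `g = Re L` there.
  let F : ((ι × ι) →₀ A) →ₗ[ℂ] ℂ := Module.Dual.extendRCLike g
  have hF : ∀ x, F x = (g x : ℂ) - Complex.I * (g (Complex.I • x) : ℂ) := fun x =>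
    Module.Dual.extendRCLike_apply g x
  refine ⟨formOfFunctional b F, fun a ha => ?_, fun m a h => ?_⟩
  · refine b.ext fun i => b.ext fun j => ?_
    rw [formOfFunctional_apply, coordMatrix_basis, hF]
    have hmem : Finsupp.single (i, j) a ∈ EB := fun kl => by
      classical
      rw [Finsupp.single_apply]
      split_ifs
      exacts [ha, B.zero_mem]
    rw [hg' _ hmem, hg' _ (EB.smul_mem _ hmem), map_smul]
    simp only [L, functionalOfForm_single]
    apply Complex.ext <;> simp
  · simp only [formOfFunctional_apply, ← map_sum]
    set x := ∑ k, ∑ l, coordMatrix b (a k * star (a l)) (h k) (h l) with hx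
    have hxp : ∀ i j, x (i, j) = (∑ k, b.repr (h k) i • a k) * star (∑ k, b.repr (h k) j • a k) := by
      intro i j
      simp only [hx, Finsupp.finsetSum_apply, coordMatrix_apply, star_sum, star_smul,
        Finset.sum_mul_sum, smul_mul_smul_comm, RCLike.star_def]
    have hxs : ∀ i j, star (x (j, i)) = x (i, j) := fun i j => by
      rw [hxp, hxp, star_mul, star_star]
    -- `x` is self-adjoint and equals `p p*`, so `x + x*` consists of two copies of `p p*`.
    have h1 : x ∈ gramCone A ι :=
      ⟨2, fun _ i => ∑ k, b.repr (h k) i • a k, fun i j => by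
        rw [hxs, Fin.sum_univ_two, hxp]⟩
    -- Both `I • x` and `-I • x` are skew-adjoint and lie in the cone. Hence `g (I • x) = 0`, and `F
    -- x = g x` is real and nonnegative.
    have h2 : ∀ c : ℂ, star c = -c → c • x ∈ gramCone A ι := fun c hc =>
      ⟨0, Fin.elim0, fun i j => by
        simp [hxs, hc, star_smul]⟩
    have h3 := hgpos _ (h2 Complex.I (by simp))
    have h4 := hgpos _ (h2 (-Complex.I) (by simp))
    rw [neg_smul, map_neg] at h4
    have h5 : g (Complex.I • x) = 0 := by linarith
    rw [hF, h5]
    simpa using hgpos _ h1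

end Extension

/-! ### The `*`-algebra of polynomials on a set of characters. -/

section Transform

variable {S : Type u} [CommMonoid S] [StarMul S] {T : Set S} {Y : Set (Dual S)}

theorem transform_mul (Y : Set (Dual S)) (s t : S) :
    transform Y (s * t) = transform Y s * transform Y t := by
  funext χ; exact map_mul _ s t

theorem transform_one (Y : Set (Dual S)) : transform Y (1 : S) = 1 := by
  funext χ; exact map_one (χ : Dual S)

theorem transform_star (Y : Set (Dual S)) (s : S) :
    transform Y (star s) = star (transform Y s) := by
  funext χ; exact map_star (χ : Dual S) s

theorem transform_mem_polySpace (Y : Set (Dual S)) {s : S} (hs : s ∈ T) :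
    transform Y s ∈ polySpace T Y :=
  Submodule.subset_span ⟨⟨s, hs⟩, rfl⟩

theorem polySpace_le_univ (T : Set S) (Y : Set (Dual S)) :
    polySpace T Y ≤ polySpace Set.univ Y :=
  Submodule.span_le.2 (by rintro _ ⟨s, rfl⟩; exact transform_mem_polySpace Y (Set.mem_univ _))

theorem star_mem_polySpace (hT : star '' T = T) {w : Y → ℂ} (hw : w ∈ polySpace T Y) :
    star w ∈ polySpace T Y := by
  induction hw using Submodule.span_induction with
  | mem w hw =>
    obtain ⟨s, rfl⟩ := hw
    simp only [← transform_star]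
    exact transform_mem_polySpace Y (hT.subset (Set.mem_image_of_mem star s.2))
  | zero => simp
  | add w w' _ _ h h' => rw [star_add]; exact add_mem h h'
  | smul c w _ h => rw [star_smul]; exact Submodule.smul_mem _ _ h

theorem mul_mem_polySpace_univ {w w' : Y → ℂ} (hw : w ∈ polySpace Set.univ Y)
    (hw' : w' ∈ polySpace Set.univ Y) : w * w' ∈ polySpace Set.univ Y := by
  induction hw using Submodule.span_induction with
  | zero => simp
  | add w w'' _ _ h h' => rw [add_mul]; exact add_mem h h'
  | smul c w _ h => rw [smul_mul_assoc]; exact Submodule.smul_mem _ _ h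
  | mem w hw =>
    obtain ⟨s, rfl⟩ := hw
    induction hw' using Submodule.span_induction with
    | zero => simp
    | add w w'' _ _ h h' => rw [mul_add]; exact add_mem h h'
    | smul c w _ h => rw [mul_smul_comm]; exact Submodule.smul_mem _ _ h
    | mem w hw =>
      obtain ⟨t, rfl⟩ := hw
      simp only [← transform_mul]
      exact transform_mem_polySpace Y (Set.mem_univ _)

/-- The space `𝒫_S(Y)` as a `*`-algebra of functions on `Y`. -/
def polyAlgebra (Y : Set (Dual S)) : StarSubalgebra ℂ (Y → ℂ) where
  carrier := polySpace Set.univ Y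
  mul_mem' := mul_mem_polySpace_univ
  add_mem' := add_mem
  algebraMap_mem' c := by
    rw [Algebra.algebraMap_eq_smul_one, ← transform_one]
    exact Submodule.smul_mem _ _ (transform_mem_polySpace Y (Set.mem_univ _))
  star_mem' := star_mem_polySpace (Set.image_univ_of_surjective star_involutive.surjective)

/-- The transform of `s`, as an element of the `*`-algebra `𝒫_S(Y)`. -/
def polyAlgebra.of (Y : Set (Dual S)) (s : S) : polyAlgebra Y :=
  ⟨transform Y s, transform_mem_polySpace Y (Set.mem_univ _)⟩

theorem span_range_polyAlgebra_of (Y : Set (Dual S)) :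
    Submodule.span ℂ (Set.range (polyAlgebra.of Y)) = ⊤ := by
  refine eq_top_iff.2 fun w _ => ?_
  obtain ⟨c, hc⟩ := Finsupp.mem_span_range_iff_exists_finsupp.1 w.2
  refine Finsupp.mem_span_range_iff_exists_finsupp.2
    ⟨c.mapDomain Subtype.val, Subtype.ext ?_⟩
  rw [← hc, Finsupp.sum_mapDomain_index (by simp) (by simp [add_smul])]
  simp [Finsupp.sum, polyAlgebra.of]

/-! ### Polynomials with values in the Hilbert space -/

theorem smul_mem_polySpaceEll2 {w : Y → ℂ} (hw : w ∈ polySpace Set.univ Y) (v : Ell2) :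
    (fun χ => w χ • v) ∈ polySpaceEll2 Y := by
  obtain ⟨c, rfl⟩ := Finsupp.mem_span_range_iff_exists_finsupp.1 hw
  refine ⟨(c.mapDomain Subtype.val).mapRange (fun z => z • v) (zero_smul _ _), fun χ => ?_⟩
  rw [Finsupp.sum_mapRange_index (by simp),
    Finsupp.sum_mapDomain_index (by simp) (by simp [add_smul])]
  simp [Finsupp.sum, Finset.sum_smul, transform, smul_smul, mul_comm]

theorem add_mem_polySpaceEll2 {p q : Y → Ell2} (hp : p ∈ polySpaceEll2 Y)
    (hq : q ∈ polySpaceEll2 Y) : p + q ∈ polySpaceEll2 Y := by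
  classical
  obtain ⟨x, hx⟩ := hp
  obtain ⟨y, hy⟩ := hq
  refine ⟨x + y, fun χ => ?_⟩
  rw [Finsupp.sum_add_index (by simp) (by simp), Pi.add_apply, hx, hy]

theorem sum_smul_mem_polySpaceEll2 {n : ℕ} {w : Fin n → Y → ℂ}
    (hw : ∀ r, w r ∈ polySpace Set.univ Y) (v : Fin n → Ell2) :
    (∑ r, fun χ => w r χ • v r) ∈ polySpaceEll2 Y :=
  Finset.sum_induction _ (· ∈ polySpaceEll2 Y) (fun _ _ => add_mem_polySpaceEll2)
    ⟨0, by simp⟩ fun r _ => smul_mem_polySpaceEll2 (hw r) (v r)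

theorem inner_sum_single {n : ℕ} (x y : Fin n → ℂ) :
    inner ℂ (∑ r, y r • (lp.single 2 (r : ℕ) (1 : ℂ) : Ell2))
      (∑ r, x r • (lp.single 2 (r : ℕ) (1 : ℂ) : Ell2)) = ∑ r, x r * star (y r) := by
  rw [sum_inner]
  refine Finset.sum_congr rfl fun r _ => ?_
  rw [inner_sum, Finset.sum_eq_single r]
  · rw [inner_smul_left, inner_smul_right, lp.inner_single_left, lp.single_apply_self]
    simp [mul_comm]
  · intro r' _ hr
    rw [inner_smul_left, inner_smul_right, lp.inner_single_left, lp.single_apply_ne]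
    · simp
    · exact fun h => hr (Fin.ext h.symm)
  · simp

/-- The `n` scalar factors become the coordinates of one `ℓ²`-valued polynomial along the first `n`
unit vectors. -/
theorem mem_polyMatrixFact_of_eq_sum {m n : ℕ} {p : Fin n → Fin m → Y → ℂ}
    (hp : ∀ r k, p r k ∈ polySpace Set.univ Y) {w : Matrix (Fin m) (Fin m) (polySpace T Y)}
    (hw : ∀ k l, (w k l : Y → ℂ) = ∑ r, p r k * star (p r l)) : w ∈ polyMatrixFact T Y m := by
  refine ⟨fun k => ∑ r : Fin n, fun χ => p r k χ • (lp.single 2 (r : ℕ) (1 : ℂ) : Ell2),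
    fun k => sum_smul_mem_polySpaceEll2 (fun r => hp r k) _, fun k l χ => ?_⟩
  simp only [Finset.sum_apply]
  rw [inner_sum_single, hw]
  simp

/-- The inner product of two polynomials is a polynomial. -/
theorem inner_mem_polySpace (Y : Set (Dual S)) (x y : S →₀ Ell2) :
    (fun χ : Y => (inner ℂ (y.sum fun s v => (χ : Dual S) s • v)
      (x.sum fun s v => (χ : Dual S) s • v) : ℂ)) ∈ polySpace Set.univ Y := by
  have e : (fun χ : Y => (inner ℂ (y.sum fun s v => (χ : Dual S) s • v)
      (x.sum fun s v => (χ : Dual S) s • v) : ℂ)) =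
      ∑ s ∈ x.support, ∑ t ∈ y.support,
        (inner ℂ (y t) (x s) : ℂ) • transform Y (star t * s) := by
    funext χ
    simp only [Finsupp.sum, sum_inner, inner_sum, inner_smul_left, inner_smul_right,
      Finset.sum_apply, Pi.smul_apply, smul_eq_mul, transform, Finset.mul_sum, map_mul, map_star, RCLike.star_def]
    refine Finset.sum_congr rfl fun t _ => Finset.sum_congr rfl fun s _ => ?_
    ring
  rw [e]
  exact Submodule.sum_mem _ fun s _ => Submodule.sum_mem _ fun t _ =>
    Submodule.smul_mem _ _ (transform_mem_polySpace Y (Set.mem_univ _))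

/-! ### Restriction of polynomials -/

/-- Restriction of functions on the dual to `Y`. -/
def restrictLM (Y : Set (Dual S)) : (↥(Set.univ : Set (Dual S)) → ℂ) →ₗ[ℂ] (Y → ℂ) :=
  LinearMap.funLeft ℂ ℂ fun χ => ⟨χ, Set.mem_univ _⟩

theorem restrictLM_transform (Y : Set (Dual S)) (s : S) :
    restrictLM Y (transform Set.univ s) = transform Y s := rfl

theorem restrictLM_mem (Y : Set (Dual S)) {w : ↥(Set.univ : Set (Dual S)) → ℂ}
    (hw : w ∈ polySpace T Set.univ) : restrictLM Y w ∈ polySpace T Y := by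
  induction hw using Submodule.span_induction with
  | mem w hw =>
    obtain ⟨s, rfl⟩ := hw
    exact transform_mem_polySpace Y s.2
  | zero => simp
  | add w w' _ _ h h' => rw [map_add]; exact add_mem h h'
  | smul c w _ h => rw [map_smul]; exact Submodule.smul_mem _ _ h

theorem exists_restrictLM_eq {w : Y → ℂ} (hw : w ∈ polySpace T Y) :
    ∃ w' ∈ polySpace T (Set.univ : Set (Dual S)), restrictLM Y w' = w := by
  induction hw using Submodule.span_induction with
  | mem w hw =>
    obtain ⟨s, rfl⟩ := hw
    exact ⟨_, transform_mem_polySpace _ s.2, restrictLM_transform Y s⟩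
  | zero => exact ⟨0, zero_mem _, map_zero _⟩
  | add w w' _ _ h h' =>
    obtain ⟨v, hv, rfl⟩ := h
    obtain ⟨v', hv', rfl⟩ := h'
    exact ⟨v + v', add_mem hv hv', map_add _ _ _⟩
  | smul c w _ h =>
    obtain ⟨v, hv, rfl⟩ := h
    exact ⟨c • v, Submodule.smul_mem _ _ hv, map_smul _ _ _⟩

/-- A polynomial vanishing on `Y` has zero coefficients by the independence of the transforms on
`Y`, so it vanishes on the whole dual. -/
theorem restrictLM_injOn (hY : IsDetermining Y) {w w' : ↥(Set.univ : Set (Dual S)) → ℂ}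
    (hw : w ∈ polySpace Set.univ Set.univ) (hw' : w' ∈ polySpace Set.univ Set.univ)
    (h : restrictLM Y w = restrictLM Y w') : w = w' := by
  rw [← sub_eq_zero] at h ⊢
  rw [← map_sub] at h
  obtain ⟨c, hc⟩ := Finsupp.mem_span_range_iff_exists_finsupp.1 (sub_mem hw hw')
  rw [← hc] at h ⊢
  rw [map_finsuppSum] at h
  have hli := hY.2.comp (Subtype.val : ↥(Set.univ : Set S) → S) Subtype.val_injective
  have := linearIndependent_iff.1 hli c (by
    rw [Finsupp.linearCombination_apply]
    simpa only [map_smul, restrictLM_transform, Function.comp_apply] using h)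
  simp [this]

/-! ### The implications between the positivity conditions. -/

variable {D : Type v} [AddCommGroup D] [Module ℂ D]

theorem lambdaMap_restrictLM (hY : IsDetermining Y) (Φ : T → SesqForm D)
    {w : ↥(Set.univ : Set (Dual S)) → ℂ} (hw : w ∈ polySpace T Set.univ) :
    lambdaMap hY Φ ⟨restrictLM Y w, restrictLM_mem Y hw⟩ = lambdaMap hY.univ Φ ⟨w, hw⟩ := by
  induction hw using Submodule.span_induction with
  | mem w hw =>
    obtain ⟨s, rfl⟩ := hw
    exact (lambdaMap_transform hY Φ s).trans (lambdaMap_transform hY.univ Φ s).symm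
  | zero =>
    exact (congrArg _ (Subtype.ext (map_zero (restrictLM Y)))).trans
      ((map_zero _).trans (map_zero (lambdaMap hY.univ Φ)).symm)
  | add w w' hw hw' h h' =>
    have h1 := congrArg₂ (· + ·) h h'
    simp only [← map_add] at h1
    exact h1
  | smul c w hw h =>
    have h1 := congrArg (c • ·) h
    simp only [← map_smul] at h1
    exact h1

theorem IsCompletelyPositive.isCompletelyFPositive (hY : IsDetermining Y) {Φ : T → SesqForm D}
    (h : IsCompletelyPositive (lambdaMap hY.univ Φ)) :
    IsCompletelyFPositive (lambdaMap hY Φ) := by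
  rintro m w ⟨p, hp, hw⟩
  choose x hx using hp
  choose w' hw' hr using fun k l => exists_restrictLM_eq (w k l).2
  -- The lifted entry and the inner product formed on the dual from the same coefficients are both
  -- polynomials over `S`, and they agree on `Y`.
  have hgram : ∀ k l, w' k l = fun χ => inner ℂ ((x l).sum fun s v => χ.1 s • v)
      ((x k).sum fun s v => χ.1 s • v) := fun k l => by
    refine restrictLM_injOn hY (polySpace_le_univ _ _ (hw' k l)) (inner_mem_polySpace _ _ _) ?_
    rw [hr]
    funext χ
    rw [hw, hx, hx]; rfl
  have h1 := h m (Matrix.of fun k l => ⟨w' k l, hw' k l⟩) fun χ => by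
    -- The transpose accounts for `inner` being conjugate-linear in its first argument.
    have h2 := (Matrix.posSemidef_gram ℂ
      fun k => (x k).sum fun s v => (χ : Dual S) s • v).transpose
    have e : (Matrix.gram ℂ fun k => (x k).sum fun s v => (χ : Dual S) s • v).transpose =
        Matrix.of fun k l => w' k l χ := by
      ext k l
      simp [hgram, Matrix.gram_apply]
    rw [e] at h2
    exact h2
  intro f
  have h2 := h1 f
  have h3 : ∀ k l, lambdaMap hY Φ (w k l) = lambdaMap hY.univ Φ ⟨w' k l, hw' k l⟩ := fun k l => by
    rw [← lambdaMap_restrictLM hY Φ (hw' k l)]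
    exact congrArg _ (Subtype.ext (hr k l).symm)
  simpa only [Matrix.map_apply, Matrix.of_apply, h3] using h2

theorem SemispectralMeasure.isCompletelyPositive
    (hU : IsDetermining (Set.univ : Set (Dual S))) {Φ : T → SesqForm D}
    (μ : SemispectralMeasure (Dual S) D)
    (hμ : ∀ s : T, μ.HasIntegral (fun χ : Dual S => χ (s : S)) (Φ s)) :
    IsCompletelyPositive (lambdaMap hU Φ) := by
  -- Diagonal values suffice, because the entries at `(h k, h l)` are recovered by polarization.
  have key : ∀ w (hw : w ∈ polySpace T (Set.univ : Set (Dual S))) f,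
      Integrable (fun χ => w ⟨χ, Set.mem_univ χ⟩) (μ.diagMeasure f) ∧
      lambdaMap hU Φ ⟨w, hw⟩ f f = ∫ χ, w ⟨χ, Set.mem_univ χ⟩ ∂(μ.diagMeasure f) := by
    intro w hw f
    induction hw using Submodule.span_induction with
    | mem w hw =>
      obtain ⟨s, rfl⟩ := hw
      refine ⟨(hμ s).integrable f, ?_⟩
      exact (congrArg (fun φ => φ f f) (lambdaMap_transform hU Φ s)).trans ((hμ s).apply_self f)
    | zero =>
      refine ⟨integrable_zero _ _ _, ?_⟩
      have : (⟨0, zero_mem _⟩ : polySpace T (Set.univ : Set (Dual S))) = 0 := rfl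
      rw [this, map_zero]
      simp
    | add w w' hw hw' h h' =>
      refine ⟨h.1.add h'.1, ?_⟩
      have : (⟨w + w', add_mem hw hw'⟩ : polySpace T (Set.univ : Set (Dual S))) =
        ⟨w, hw⟩ + ⟨w', hw'⟩ := rfl
      rw [this, map_add, LinearMap.add_apply, LinearMap.add_apply, h.2, h'.2]
      exact (integral_add h.1 h'.1).symm
    | smul c w hw h =>
      refine ⟨h.1.const_mul c, ?_⟩
      have : (⟨c • w, Submodule.smul_mem _ c hw⟩ : polySpace T (Set.univ : Set (Dual S))) =
        c • ⟨w, hw⟩ := rfl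
      rw [this, map_smul, LinearMap.smul_apply, LinearMap.smul_apply, h.2, smul_eq_mul]
      exact (integral_const_mul c _).symm
  intro m w hw h
  have h1 := μ.sum_polar_integral_nonneg h (w := fun k l χ => (w k l : ↥(Set.univ : Set (Dual S)) → ℂ) ⟨χ, Set.mem_univ χ⟩)
    (fun k l f => (key _ (w k l).2 f).1) fun χ => hw ⟨χ, Set.mem_univ χ⟩
  refine h1.trans_eq (Finset.sum_congr rfl fun k _ => Finset.sum_congr rfl fun l _ => ?_)
  rw [Matrix.map_apply, polarization, polar]
  simp only [← fun f => (key _ (w k l).2 f).2]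

theorem IsCompletelyFPositive.exists_isPositiveDefinite (hT_symm : star '' T = T)
    (hT_herm : {s : S | star s = s} ⊆ T) (hY : IsDetermining Y) {Φ : T → SesqForm D}
    (h : IsCompletelyFPositive (lambdaMap hY Φ)) :
    ∃ Ψ : S → SesqForm D, IsPositiveDefinite Ψ ∧ ∀ s : T, Ψ (s : S) = Φ s := by
  let A := polyAlgebra Y
  let B : Submodule ℂ A := (polySpace T Y).comap A.toSubalgebra.toSubmodule.subtype
  have hB : ∀ a : A, a ∈ B ↔ (a : Y → ℂ) ∈ polySpace T Y := fun a => Iff.rfl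
  let ΛB : B →ₗ[ℂ] SesqForm D := lambdaMap hY Φ ∘ₗ
    { toFun := fun a => ⟨((a : A) : Y → ℂ), a.2⟩
      map_add' := fun _ _ => rfl
      map_smul' := fun _ _ => rfl }
  -- An arbitrary linear extension to `A`; only its values on `B` enter the hypotheses below.
  obtain ⟨Λ, hΛ⟩ := ΛB.exists_extend
  have hΛ' : ∀ (a : A) (ha : a ∈ B), Λ a = lambdaMap hY Φ ⟨a, ha⟩ := fun a ha =>
    LinearMap.congr_fun hΛ ⟨a, ha⟩
  have hof : ∀ s ∈ T, polyAlgebra.of Y s ∈ B := fun s hs => transform_mem_polySpace Y hs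
  have hmul : ∀ s t, polyAlgebra.of Y s * star (polyAlgebra.of Y t) =
      polyAlgebra.of Y (star t * s) := fun s t => Subtype.ext (by
    change transform Y s * star (transform Y t) = transform Y (star t * s)
    rw [transform_mul, transform_star, mul_comm])
  have hsq : ∀ s, polyAlgebra.of Y s * star (polyAlgebra.of Y s) ∈ B := fun s => by
    rw [hmul]
    refine hof _ (hT_herm ?_)
    change star (star s * s) = star s * s
    rw [star_mul, star_star]
  obtain ⟨Ψ, hΨ, hpos⟩ := exists_positive_extension (B := B)
    (fun a ha => star_mem_polySpace hT_symm ha) (span_range_polyAlgebra_of Y)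
    (by
      have := transform_mem_polySpace Y (hT_herm (star_one S))
      rw [transform_one] at this
      exact this)
    (by rintro _ ⟨s, rfl⟩; exact hsq s)
    -- `a * star a` may leave `B` for a general `a ∈ B`, but not for the transforms of elements of
    -- `T`, which span `B`.
    (fun a ha => by
      obtain ⟨c, hc⟩ := Finsupp.mem_span_range_iff_exists_finsupp.1 ((hB a).1 ha)
      have : a = c.sum fun s z => z • polyAlgebra.of Y (s : S) := Subtype.ext (by
        rw [← hc]; simp [Finsupp.sum, polyAlgebra.of])
      rw [this]
      exact Submodule.sum_mem _ fun s _ => Submodule.smul_mem _ _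
        (Submodule.subset_span ⟨hof s s.2, hsq s⟩))
    Λ (fun m n p hp f => by
      have := h m (Matrix.of fun k l => ⟨_, (hB _).1 (hp k l)⟩)
        (mem_polyMatrixFact_of_eq_sum (p := fun r k => (p r k : Y → ℂ)) (fun r k => (p r k).2)
          fun k l => by simp) f
      simpa only [Matrix.map_apply, Matrix.of_apply, hΛ' _ (hp _ _)] using this)
  refine ⟨fun s => Ψ (polyAlgebra.of Y s), fun m s f => ?_, fun s => ?_⟩
  · simpa only [hmul] using hpos m (fun k => polyAlgebra.of Y (s k)) f
  · beta_reduce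
    rw [hΨ _ (hof s s.2), hΛ' _ (hof s s.2)]
    exact lambdaMap_transform hY Φ s

end Transform
end StarSemigroup
end

open StarSemigroup
theorem theorem2p1 {S : Type u} [CommMonoid S] [StarMul S]
    (hS : IsOperatorSemiperfect.{u, v} S)
    (T : Set S) (hT_symm : star '' T = T) (hT_herm : {s : S | star s = s} ⊆ T)
    (Y : Set (Dual S)) (hY : IsDetermining Y)
    {D : Type v} [AddCommGroup D] [Module ℂ D] (Φ : T → SesqForm D) :
    List.TFAE [
      ∃ Ψ : S → SesqForm D, IsPositiveDefinite Ψ ∧ ∀ s : T, Ψ (s : S) = Φ s,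
      ∃ μ : SemispectralMeasure (Dual S) D,
        ∀ s : T, μ.HasIntegral (fun χ : Dual S => χ (s : S)) (Φ s),
      IsCompletelyPositive (lambdaMap hY.univ Φ),
      IsCompletelyFPositive (lambdaMap hY Φ)] := by
  tfae_have 1 → 2 := by
    rintro ⟨Ψ, hΨ, hΦ⟩
    obtain ⟨μ, hμ⟩ := hS D Ψ hΨ
    exact ⟨μ, fun s => hΦ s ▸ hμ s⟩
  tfae_have 2 → 3 := by
    rintro ⟨μ, hμ⟩
    exact μ.isCompletelyPositive hY.univ hμ
  tfae_have 3 → 4 := IsCompletelyPositive.isCompletelyFPositive hY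
  tfae_have 4 → 1 := IsCompletelyFPositive.exists_isPositiveDefinite hT_symm hT_herm hY
  tfae_finish
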